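/- **Definitions.** A valued field $(K,v)$ is a field $K$ with a valuation $v$ onto $\Gamma\cup\{\infty\}$, where $\Gamma=v(K^\times)$ is an ordered abelian group (the valuation group; the trivial valuation is allowed). Its ring of integers is $\mathcal O_K=\{x\in K: v(x)\ge 0\}$, with maximal ideal $\mathfrak m_K=\{x\in K: v(x)>0\}$, and its residue field is $k=\mathcal O_K/\mathfrak m_K$. A complete first-order theory is NIP if there are no formula $\varphi(\bar x,\bar y)$ and no model of the theory containing tuples $(\bar a_i)_{i\in\omega}$, $(\bar b_I)_{I\subseteq\omega}$ such that $\varphi(\bar a_i,\bar b_I)$ holds if and only if $i\in I$. The valued field $(K,v)$ is called NIP if the theory of the three-sorted structure $(K,\Gamma,k)$ is NIP, where $K$ and $k$ carry their field structure, $\Gamma$ carries its ordered group structure, and the structure also includes the maps $v:K^\times\to\Gamma$ and $\mathcal O_K\to k$. A valued field is *algebraically maximal* if it has no non-trivial algebraic immediate extension, that is, no non-trivial algebraic valued field extension with the same valuation group and the same residue field. A valued field of characteristic $p>0$ is *tame* if it is algebraically maximal, $\Gamma$ is $p$-divisible and $k$ is perfect. It is *Kaplansky* if $\Gamma$ is $p$-divisible,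 and $k$ is perfect and has no finite separable extension of degree divisible by $p$. **Corollary 5.10** (tame iff Kaplansky). Let $p$ be a prime and let $(K,v)$ be an algebraically maximal NIP valued field with $K$ infinite of characteristic $p$. Then the following are equivalent: 1. $(K,v)$ is tame; 2. $(K,v)$ is Kaplansky; 3. the residue field $k$ is perfect. -/

import Mathlib

universe u v

/-! ### Theories with and without the independence property -/

namespace FirstOrder.Language

variable {L : Language.{u, v}}

/-- The theory `T` has the independence property: some formula `φ(x̄, ȳ)` and some model of `T`
contain tuples `a i` (for `i ∈ ω`) and `b I` (for `I ⊆ ω`) such that `φ(a i, b I)` holds if and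
only if `i ∈ I`. (By Löwenheim-Skolem it does not matter in which universe the model is sought:
every such pattern, which involves at most continuum many elements, occurs in a model that lives
in the universe of the language.) -/
def Theory.HasIndependenceProperty (T : L.Theory) : Prop :=
  ∃ (m n : ℕ) (φ : L.Formula (Fin m ⊕ Fin n)) (M : Theory.ModelType.{u, v, max u v} T)
    (a : ℕ → Fin m → M) (b : Set ℕ → Fin n → M),
    ∀ (i : ℕ) (I : Set ℕ), φ.Realize (Sum.elim (a i) (b I)) ↔ i ∈ I

/-- A theory is NIP if it does not have the independence property. -/
def Theory.IsNIP (T : L.Theory) : Prop :=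
  ¬ T.HasIndependenceProperty

end FirstOrder.Language

/-! ### Valued fields as three-sorted structures

A valued field is a field `K` with a surjective `v : Valuation K Γ₀`. Valuations are written
multiplicatively and with the order reversed: the valuation group is `Γ₀ˣ`, the element `0 : Γ₀`
plays the role of `∞`, and `v x ≤ 1` means that `x` is integral. -/

namespace ValuedField

/-- The relation symbols of the three-sorted language of valued fields. The sorts are given by
unary predicates, and operations by their graphs. -/
inductive Rel : ℕ → Type
  | fieldSort : Rel 1
  | groupSort : Rel 1
  | residueSort : Rel 1
  | fieldAdd : Rel 3
  | fieldMul : Rel 3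
  | groupMul : Rel 3
  | groupLE : Rel 2
  | residueAdd : Rel 3
  | residueMul : Rel 3
  | val : Rel 2
  | res : Rel 2

/-- The (relational) three-sorted language of valued fields. -/
def language : FirstOrder.Language.{0, 0} where
  Functions _ := Empty
  Relations := Rel

variable {K : Type u} [Field K] {Γ₀ : Type v} [LinearOrderedCommGroupWithZero Γ₀]

/-- The residue field `k` of a valued field `(K, v)`. -/
abbrev Residue (v : Valuation K Γ₀) : Type u :=
  IsLocalRing.ResidueField v.valuationSubring

/-- The disjoint union of the three sorts `K`, `Γ`, `k` of the valued field `(K, v)`. -/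
inductive Sorts (v : Valuation K Γ₀) : Type (max u v)
  | field (x : K)
  | group (g : Γ₀ˣ)
  | residue (r : Residue v)

/-- The interpretation of the relation symbols: the field operations of `K`, the operation and
the order of `Γ`, the field operations of `k`, the valuation `v : Kˣ → Γ` and the quotient map
from the ring of integers of `K` to `k`. -/
def Rel.Holds (v : Valuation K Γ₀) : {n : ℕ} → Rel n → (Fin n → Sorts v) → Prop
  | _, .fieldSort, s => ∃ x : K, s = ![.field x]
  | _, .groupSort, s => ∃ g : Γ₀ˣ, s = ![.group g]
  | _, .residueSort, s => ∃ r : Residue v, s = ![.residue r]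
  | _, .fieldAdd, s => ∃ x y : K, s = ![.field x, .field y, .field (x + y)]
  | _, .fieldMul, s => ∃ x y : K, s = ![.field x, .field y, .field (x * y)]
  | _, .groupMul, s => ∃ g h : Γ₀ˣ, s = ![.group g, .group h, .group (g * h)]
  | _, .groupLE, s => ∃ g h : Γ₀ˣ, g ≤ h ∧ s = ![.group g, .group h]
  | _, .residueAdd, s => ∃ q r : Residue v, s = ![.residue q, .residue r, .residue (q + r)]
  | _, .residueMul, s => ∃ q r : Residue v, s = ![.residue q, .residue r, .residue (q * r)]
  | _, .val, s => ∃ (x : K) (g : Γ₀ˣ), v x = g ∧ s = ![.field x, .group g]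
  | _, .res, s => ∃ x : v.valuationSubring,
      s = ![.field (x : K), .residue (IsLocalRing.residue v.valuationSubring x)]

/-- The valued field `(K, v)` as a three-sorted structure `(K, Γ, k)`. -/
instance (v : Valuation K Γ₀) : language.Structure (Sorts v) where
  funMap f _ := Empty.elim f
  RelMap r s := Rel.Holds v r s

/-- The valued field `(K, v)` is NIP: the complete theory of the three-sorted structure
`(K, Γ, k)` is NIP. -/
def IsNIP (v : Valuation K Γ₀) : Prop :=
  (language.completeTheory (Sorts v)).IsNIP

/-! ### Algebraically maximal, Kaplansky and tame valued fields -/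

/-- An extension `(L, w)` of the valued field `(K, v)` is immediate if it has the same valuation
group and the same residue field, i.e. if the canonical embeddings of the valuation group and of
the residue field of `K` into those of `L` are onto. -/
def IsImmediate {L : Type*} [Field L] [Algebra K L] {Γ₁ : Type*}
    [LinearOrderedCommGroupWithZero Γ₁] (v : Valuation K Γ₀) (w : Valuation L Γ₁)
    [v.HasExtension w] : Prop :=
  (∀ y : L, ∃ x : K, w (algebraMap K L x) = w y) ∧
    Function.Surjective (algebraMap (Residue v) (Residue w))

/-- `(K, v)` is algebraically maximal: it has no non-trivial algebraic immediate extension.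
(Up to isomorphism every algebraic immediate extension lives in the universes of `K` and `Γ₀`.) -/
def IsAlgebraicallyMaximal (v : Valuation K Γ₀) : Prop :=
  ∀ (L : Type u) [Field L] [Algebra K L] [Algebra.IsAlgebraic K L]
    (Γ₁ : Type v) [LinearOrderedCommGroupWithZero Γ₁] (w : Valuation L Γ₁) [v.HasExtension w],
    IsImmediate v w → Function.Surjective (algebraMap K L)

/-- The valuation group `Γ = Γ₀ˣ` is `p`-divisible (in multiplicative notation). -/
def IsGroupDivisible (p : ℕ) (Γ₀ : Type v) [LinearOrderedCommGroupWithZero Γ₀] : Prop :=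
  ∀ g : Γ₀ˣ, ∃ h : Γ₀ˣ, h ^ p = g

/-- A valued field `(K, v)` of characteristic `p > 0` is Kaplansky if its valuation group is
`p`-divisible and its residue field is perfect and has no finite separable extension whose degree
is divisible by `p`. -/
structure IsKaplansky (p : ℕ) (v : Valuation K Γ₀) : Prop where
  divisible : IsGroupDivisible p Γ₀
  perfect : PerfectField (Residue v)
  not_dvd_finrank : ∀ (l : Type u) [Field l] [Algebra (Residue v) l]
    [FiniteDimensional (Residue v) l] [Algebra.IsSeparable (Residue v) l],
    ¬ p ∣ Module.finrank (Residue v) l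

/-- A valued field `(K, v)` of characteristic `p > 0` is tame if it is algebraically maximal, its
valuation group is `p`-divisible and its residue field is perfect. -/
structure IsTame (p : ℕ) (v : Valuation K Γ₀) : Prop where
  algebraicallyMaximal : IsAlgebraicallyMaximal v
  divisible : IsGroupDivisible p Γ₀
  perfect : PerfectField (Residue v)

end ValuedField

/-! Write ℘(x) = x ^ p - x. Everything rests on the Kaplan–Scanlon–Wagner theorem: on an infinite
field of characteristic p definable in an NIP structure, ℘ is onto. By compactness, NIP bounds the
size of the finite sets shattered by the relation "t * b lies in ℘(F)" or by its complement. If ℘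
were not onto, `exists_forall_isArtinSchreierClosed` would give, for every n, elements b 0, …, b n
such that none of the subgroups {t | t * b i ∈ ℘(F)} contains the intersection of the others. Sums
of witnesses would then shatter arbitrarily large sets.

Applied to K, this makes Γ p-divisible, since a ℘-preimage of an element of negative valuation has
exactly 1/p of that valuation. It also makes k Artin-Schreier closed, hence infinite. The theorem
then applies to all finite extensions of k, encoded by coordinates. A finite separable extension of
k of degree divisible by p would yield, through an automorphism of order p of its normal closure, a
finite extension of k on which ℘ is not onto. So perfectness of k is the only condition left open in
both "tame" and "Kaplansky". -/

/-! ### NIP and finite VC dimension, by compactness. -/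

namespace FirstOrder.Language

open Set

/-- If a formula shatters arbitrarily large finite sets in a model, then the theory has the
independence property. -/
theorem Theory.hasIndependenceProperty_of_finite_patterns {L : Language.{0, 0}} {M : Type*}
    [L.Structure M] [Nonempty M] {m n : ℕ} (φ : L.Formula (Fin m ⊕ Fin n))
    (h : ∀ N : ℕ, ∃ (a : Fin N → Fin m → M) (b : Set (Fin N) → Fin n → M),
      ∀ i I, φ.Realize (Sum.elim (a i) (b I)) ↔ i ∈ I) :
    (L.completeTheory M).HasIndependenceProperty := by
  classical
  -- New constants name the tuples of the infinite pattern. Finitely many of its conditions involve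
  -- only indices below some `N`, so a pattern of size `N` satisfies them; for this the set `I` is
  -- replaced by its trace on `Fin N`.
  let C : Type := (ℕ × Fin m) ⊕ (Set ℕ × Fin n)
  let ψ : ℕ × Set ℕ → L.Formula C := fun x =>
    φ.relabel (Sum.map (fun j => (x.1, j)) (fun j => (x.2, j)))
  let σ : ℕ × Set ℕ → L[[C]].Sentence := fun x =>
    Formula.equivSentence (if x.1 ∈ x.2 then ψ x else (ψ x).not)
  let T : ℕ × Set ℕ → L[[C]].Theory := fun x =>
    (L.lhomWithConstants C).onTheory (L.completeTheory M) ∪ {σ x}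
  have hsat : Theory.IsSatisfiable (⋃ x, T x) := by
    rw [Theory.isSatisfiable_iUnion_iff_isSatisfiable_iUnion_finset]
    intro s
    obtain ⟨N, hN⟩ : ∃ N : ℕ, ∀ x ∈ s, x.1 < N :=
      ⟨s.sup Prod.fst + 1, fun x hx => Nat.lt_succ_of_le (Finset.le_sup (f := Prod.fst) hx)⟩
    obtain ⟨a, b, hab⟩ := h N
    let c : C → M := Sum.elim
      (fun x => if hx : x.1 < N then a ⟨x.1, hx⟩ x.2 else Classical.arbitrary M)
      (fun x => b {k | (k : ℕ) ∈ x.1} x.2)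
    let _ : (constantsOn C).Structure M := constantsOn.structure c
    have hM : M ⊨ ⋃ x ∈ s, T x := by
      simp only [Theory.model_iff, mem_iUnion]
      rintro τ ⟨x, hx, hτ | hτ⟩
      · have : M ⊨ (L.lhomWithConstants C).onTheory (L.completeTheory M) :=
          (LHom.onTheory_model _ _).2 inferInstance
        exact Theory.realize_sentence_of_mem _ hτ
      · rw [mem_singleton_iff.1 hτ, Formula.realize_equivSentence]
        have hψ : (ψ x).Realize (fun k => (L.con k : M)) ↔ x.1 ∈ x.2 := by
          rw [Formula.realize_relabel]
          have := hab ⟨x.1, hN x hx⟩ {k | (k : ℕ) ∈ x.2}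
          rw [mem_ofPred_eq] at this
          rw [← this]
          refine iff_of_eq (congrArg _ (funext ?_))
          rintro (j | j)
          · change c (Sum.inl (x.1, j)) = _
            simp [c, hN x hx]
          · rfl
        split_ifs with hmem
        · exact hψ.2 hmem
        · exact fun hr => hmem (hψ.1 hr)
    exact Theory.Model.isSatisfiable M
  obtain ⟨P⟩ := hsat
  have hPσ : ∀ x, (σ x).Realize P := fun x =>
    Theory.realize_sentence_of_mem (⋃ x, T x) (mem_iUnion.2 ⟨x, Or.inr rfl⟩)
  let Q := Theory.ModelType.reduct (L.lhomWithConstants C)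
    (P.subtheoryModel (T' := (L.lhomWithConstants C).onTheory (L.completeTheory M))
      (fun τ hτ => mem_iUnion.2 ⟨(0, ∅), Or.inl hτ⟩))
  let _ : L.Structure P := (L.lhomWithConstants C).reduct P
  have : (L.lhomWithConstants C).IsExpansionOn P := LHom.isExpansionOn_reduct _ _
  refine ⟨m, n, φ, Q, fun i j => (L.con (Sum.inl (i, j) : C) : P),
    fun I j => (L.con (Sum.inr (I, j) : C) : P), fun i I => ?_⟩
  have key := hPσ (i, I)
  rw [Formula.realize_equivSentence] at key
  have hψ : (ψ (i, I)).Realize (fun k => (L.con k : P)) ↔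
      φ.Realize (M := P) (Sum.elim (fun j => (L.con (Sum.inl (i, j) : C) : P))
        (fun j => (L.con (Sum.inr (I, j) : C) : P))) := by
    rw [Formula.realize_relabel]
    refine iff_of_eq (congrArg _ (funext ?_))
    rintro (j | j) <;> rfl
  refine hψ.symm.trans ?_
  by_cases hi : i ∈ I
  · simp only [hi, if_true] at key
    exact iff_of_true key hi
  · simp only [hi, if_false] at key
    exact iff_of_false key hi

/-- In a structure with NIP theory, every relation definable with parameters has finite
VC dimension. -/
theorem Theory.IsNIP.exists_forall_not_shatters {L : Language.{0, 0}} {M : Type*}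
    [L.Structure M] [Nonempty M] (h : (L.completeTheory M).IsNIP) {A : Set M} {α β : Type*}
    [Finite α] [Finite β] {S : Set (α ⊕ β → M)} (hS : A.Definable L S) :
    ∃ N : ℕ, ∀ (a : Fin N → α → M) (b : Set (Fin N) → β → M),
      ¬ ∀ i I, Sum.elim (a i) (b I) ∈ S ↔ i ∈ I := by
  by_contra! hcon
  obtain ⟨A₀, -, hA₀⟩ := definable_iff_finitely_definable.1 hS
  obtain ⟨φ, hφ⟩ := definable_iff_exists_formula_sum.1 hA₀
  -- The finitely many parameters of the definition are absorbed into the tuples `a i`.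
  obtain ⟨m, ⟨em⟩⟩ := Finite.exists_equiv_fin ((A₀ : Set M) ⊕ α)
  obtain ⟨n, ⟨en⟩⟩ := Finite.exists_equiv_fin β
  refine h (Theory.hasIndependenceProperty_of_finite_patterns (m := m) (n := n)
    (φ.relabel (Sum.elim (fun c => Sum.inl (em (Sum.inl c)))
      (Sum.elim (fun x => Sum.inl (em (Sum.inr x))) (fun y => Sum.inr (en y))))) fun N => ?_)
  obtain ⟨a, b, hab⟩ := hcon N
  refine ⟨fun i j => Sum.elim (fun c : (A₀ : Set M) => (c : M)) (a i) (em.symm j),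
    fun I j => b I (en.symm j), fun i I => ?_⟩
  rw [← hab i I, hφ, mem_ofPred_eq, Formula.realize_relabel]
  refine iff_of_eq (congrArg _ (funext ?_))
  rintro (c | x | y) <;> simp

end FirstOrder.Language

/-! ### Moore matrices and the Artin-Schreier map. -/

section ArtinSchreier

open Polynomial

/-- A field is Artin-Schreier closed (for the exponent `p`) if `x ↦ x ^ p - x` is onto. -/
def IsArtinSchreierClosed (p : ℕ) (F : Type*) [Field F] : Prop :=
  ∀ a : F, ∃ x : F, x ^ p - x = a

variable {p : ℕ} [hp : Fact p.Prime] {F : Type*} [Field F] [CharP F p]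

/-- The rows of a Moore matrix are independent if its entries in the first row are linearly
independent over the prime field. -/
theorem moore_linearIndependent [Algebra (ZMod p) F] {m : ℕ} {c : Fin m → F}
    (hc : LinearIndependent (ZMod p) c) (l : Fin m → F)
    (h : ∀ i, ∑ j : Fin m, l j * c i ^ p ^ (j : ℕ) = 0) : l = 0 := by
  classical
  -- This additive polynomial has degree below `p ^ m` but vanishes on the span of `c`, which has `p
  -- ^ m` elements.
  let P : F[X] := ∑ j : Fin m, C (l j) * X ^ p ^ (j : ℕ)
  have heval : ∀ x, P.eval x = ∑ j : Fin m, l j * x ^ p ^ (j : ℕ) := fun x => by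
    simp [P, eval_finsetSum]
  have hspan : ∀ x ∈ Submodule.span (ZMod p) (Set.range c), P.eval x = 0 := by
    intro x hx
    induction hx using Submodule.span_induction with
    | mem x hx => obtain ⟨i, rfl⟩ := hx; rw [heval, h]
    | zero => rw [heval]; exact Finset.sum_eq_zero fun j _ => by simp [hp.out.ne_zero]
    | add x y _ _ hx hy =>
      rw [heval] at hx hy ⊢
      simp only [add_pow_char_pow, mul_add, Finset.sum_add_distrib, hx, hy, add_zero]
    | smul r x _ hx =>
      rw [heval] at hx ⊢
      simp only [_root_.smul_pow, ZMod.pow_card_pow, mul_smul_comm, ← Finset.smul_sum, hx, smul_zero]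
  have hP : P = 0 := by
    by_contra hP
    have hsub : (Submodule.span (ZMod p) (Set.range c) : Set F) ⊆ P.roots.toFinset := fun x hx => by
      simpa [hP] using hspan x hx
    have hfin : Module.Finite (ZMod p) (Submodule.span (ZMod p) (Set.range c)) :=
      Module.Finite.span_of_finite _ (Set.finite_range c)
    have hcard : (Submodule.span (ZMod p) (Set.range c) : Set F).ncard = p ^ m := by
      have h1 := Module.natCard_eq_pow_finrank (K := ZMod p)
        (V := Submodule.span (ZMod p) (Set.range c))
      rw [finrank_span_eq_card hc, Nat.card_zmod, Fintype.card_fin] at h1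
      exact h1
    have h1 : p ^ m ≤ P.natDegree := by
      rw [← hcard]
      refine (Set.ncard_le_ncard hsub (Finset.finite_toSet _)).trans ?_
      rw [Set.ncard_coe_finset]
      exact P.roots.toFinset_card_le.trans P.card_roots'
    have h2 : P.degree < (p ^ m : ℕ) := by
      refine lt_of_le_of_lt (degree_sum_le _ _) ((Finset.sup_lt_iff (WithBot.bot_lt_coe _)).2 ?_)
      intro j _
      exact (degree_C_mul_X_pow_le _ _).trans_lt
        (by exact_mod_cast Nat.pow_lt_pow_right hp.out.one_lt j.2)
    rw [degree_eq_natDegree hP] at h2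
    exact absurd h1 (not_le.2 (by exact_mod_cast h2))
  funext j
  have hj : P.coeff (p ^ (j : ℕ)) = l j := by
    have hinj : ∀ k : Fin m, p ^ (j : ℕ) = p ^ (k : ℕ) ↔ j = k := fun k => by
      rw [Nat.pow_right_inj hp.out.one_lt, Fin.ext_iff]
    simp [P, finsetSum_coeff, coeff_X_pow, hinj]
  rw [← hj, hP, coeff_zero, Pi.zero_apply]

/-- The Moore matrix `c i ^ p ^ j` (with row index `j`). -/
def mooreMatrix (p : ℕ) {m : ℕ} (c : Fin m → F) : Matrix (Fin m) (Fin m) F :=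
  Matrix.of fun j i => c i ^ p ^ (j : ℕ)

theorem isUnit_mooreMatrix [Algebra (ZMod p) F] {m : ℕ} {c : Fin m → F}
    (hc : LinearIndependent (ZMod p) c) : IsUnit (mooreMatrix p c) := by
  rw [← Matrix.vecMul_injective_iff_isUnit]
  refine (injective_iff_map_eq_zero (Matrix.vecMulLinear (mooreMatrix p c))).2 fun l hl => ?_
  refine moore_linearIndependent hc l fun i => ?_
  exact congrFun hl i

theorem moore_eq_zero [Algebra (ZMod p) F] {m : ℕ} {c : Fin m → F}
    (hc : LinearIndependent (ZMod p) c) {x : Fin m → F}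
    (hx : ∀ j < m, ∑ i, c i ^ p ^ j * x i = 0) : x = 0 :=
  Matrix.mulVec_injective_iff_isUnit.2 (isUnit_mooreMatrix hc) (by
    rw [Matrix.mulVec_zero]
    funext j
    exact hx j j.2)

theorem moore_exists [Algebra (ZMod p) F] {m : ℕ} {c : Fin m → F}
    (hc : LinearIndependent (ZMod p) c) (y : ℕ → F) :
    ∃ x : Fin m → F, ∀ j < m, ∑ i, c i ^ p ^ j * x i = y j := by
  obtain ⟨x, hx⟩ := Matrix.mulVec_surjective_iff_isUnit.2 (isUnit_mooreMatrix hc)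
    (fun j : Fin m => y j)
  exact ⟨x, fun j hj => congrFun hx ⟨j, hj⟩⟩

theorem LinearIndependent.pow_char [Algebra (ZMod p) F] {m : ℕ} {c : Fin m → F}
    (hc : LinearIndependent (ZMod p) c) : LinearIndependent (ZMod p) (fun i => c i ^ p) := by
  rw [Fintype.linearIndependent_iff] at hc ⊢
  intro g hg i
  refine hc g ?_ i
  have : (∑ i, g i • c i) ^ p = 0 := by
    rw [sum_pow_char, ← hg]
    simp only [_root_.smul_pow, ZMod.pow_card]
  exact pow_eq_zero_iff hp.out.ne_zero |>.1 this

/-- For every number `n` there are nonzero `b 0, …, b n` such that `F` is Artin-Schreier closed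
as soon as one of the subgroups `{t | t * b i ∈ ℘(F)}` contains the intersection of the others. -/
theorem exists_forall_isArtinSchreierClosed [Infinite F] (n : ℕ) :
    ∃ b : Fin (n + 1) → F, ∀ i₀,
      (∀ t, (∀ i, i ≠ i₀ → ∃ x, x ^ p = x + t * b i) → ∃ x, x ^ p = x + t * b i₀) →
        IsArtinSchreierClosed p F := by
  let _ : Algebra (ZMod p) F := ZMod.algebra F p
  obtain ⟨c, hc⟩ : ∃ c : Fin (n + 1) → F, LinearIndependent (ZMod p) c := by
    refine exists_linearIndependent_of_le_rank ?_
    refine (Cardinal.natCast_lt_aleph0.le).trans (not_lt.1 fun h => ?_)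
    have : Module.Finite (ZMod p) F := Module.rank_lt_aleph0_iff.1 h
    exact Infinite.not_finite (Module.finite_of_finite (ZMod p) (M := F))
  have hc' := hc.pow_char
  -- the kernel vector of the Moore matrix without its first row
  obtain ⟨b, hb0, hb⟩ : ∃ b : Fin (n + 1) → F, b ≠ 0 ∧
      ∀ j < n, ∑ i, (c i ^ p) ^ p ^ j * b i = 0 := by
    obtain ⟨b, hb⟩ := moore_exists hc' (fun j => if j = n then 1 else 0)
    refine ⟨b, ?_, fun j hj => by rw [hb j (by omega), if_neg hj.ne]⟩
    rintro rfl
    simpa using hb n (Nat.lt_succ_self n)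
  have hbi : ∀ i, b i ≠ 0 := by
    intro i hi
    refine hb0 ?_
    -- If `b i = 0`, the other `n` entries are killed by an invertible `n × n` Moore matrix.
    have h := moore_eq_zero (hc'.comp _ i.succAbove_right_injective)
      (x := fun k => b (i.succAbove k)) fun j hj => by
        have := hb j hj
        rwa [Fin.sum_univ_succAbove _ i, hi, mul_zero, zero_add] at this
    funext k
    rcases eq_or_ne k i with rfl | hk
    · exact hi
    · obtain ⟨l, rfl⟩ := Fin.exists_succAbove_eq hk
      exact congrFun h l
  refine ⟨b, fun i₀ H z => ?_⟩
  have hc0 : c i₀ ≠ 0 := hc.ne_zero i₀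
  -- scale so that the coefficient at `i₀` is `1`
  let e : Fin (n + 1) → F := fun i => c i / c i₀
  have he0 : e i₀ = 1 := div_self hc0
  have heb : ∀ j < n, ∑ i, e i ^ p ^ (j + 1) * b i = 0 := fun j hj => by
    have := hb j hj
    simp only [e, div_pow, div_mul_eq_mul_div, ← Finset.sum_div]
    rw [div_eq_zero_iff]
    left
    rw [← this]
    simp only [← pow_mul, pow_succ']
  let d : Fin n → F := fun k => e (i₀.succAbove k) ^ p - e (i₀.succAbove k)
  have hdpow : ∀ k j, d k ^ p ^ j = e (i₀.succAbove k) ^ p ^ (j + 1) - e (i₀.succAbove k) ^ p ^ j :=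
    fun k j => by simp only [d, sub_pow_char_pow, ← pow_mul, pow_succ']
  -- The kernel of ℘ is the prime field, spanned by `e i₀ = 1`, and the `e i` are independent; hence
  -- so are the images `d k` of the others.
  have hd : LinearIndependent (ZMod p) d := by
    rw [Fintype.linearIndependent_iff] at hc ⊢
    intro g hg
    have hfix : (∑ k, g k • e (i₀.succAbove k)) ^ p = ∑ k, g k • e (i₀.succAbove k) := by
      rw [← sub_eq_zero, sum_pow_char, ← hg, ← Finset.sum_sub_distrib]
      simp only [d, _root_.smul_pow, ZMod.pow_card, smul_sub]
    obtain ⟨r, hr⟩ : ∃ r : ZMod p, algebraMap (ZMod p) F r = ∑ k, g k • e (i₀.succAbove k) := by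
      rw [← Subfield.mem_bot_iff_pow_eq_self F p, ← ZMod.fieldRange_castHom_eq_bot p] at hfix
      exact hfix
    have h0 : ∀ i, (i₀.insertNth (-r) g : Fin (n + 1) → ZMod p) i = 0 := by
      refine hc _ ?_
      have h1 : ∑ i, (i₀.insertNth (-r) g : Fin (n + 1) → ZMod p) i • e i = 0 := by
        rw [Fin.sum_univ_succAbove _ i₀]
        simp only [Fin.insertNth_apply_same, Fin.insertNth_apply_succAbove, ← hr, he0]
        rw [neg_smul, Algebra.smul_def, mul_one, neg_add_cancel]
      rw [← zero_mul (c i₀), ← h1, Finset.sum_mul]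
      refine Finset.sum_congr rfl fun i _ => ?_
      rw [smul_mul_assoc, div_mul_cancel₀ _ hc0]
    intro k
    simpa using h0 (i₀.succAbove k)
  -- With a single subgroup the intersection of the others is all of `F`.
  rcases n with _ | n
  · obtain ⟨x, hx⟩ := H (z / b i₀) fun i hi => absurd (Subsingleton.elim (α := Fin 1) i i₀) hi
    exact ⟨x, by rw [hx, div_mul_cancel₀ _ (hbi _), add_sub_cancel_left]⟩
  obtain ⟨x, hx⟩ := moore_exists hd (fun j => z ^ p ^ j)
  have hb' : ∀ j < n + 1, ∑ k, e (i₀.succAbove k) ^ p ^ (j + 1) * b (i₀.succAbove k) = -b i₀ :=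
    fun j hj => by
      have := heb j hj
      rw [Fin.sum_univ_succAbove _ i₀, he0, one_pow, one_mul, add_comm] at this
      exact eq_neg_of_add_eq_zero_left this
  obtain ⟨t, ht⟩ : ∃ t, ∀ k, x k ^ p = x k + t * b (i₀.succAbove k) := by
    -- Comparing the Frobenius of equation `j` with equation `j + 1` shows that `x k ^ p - x k` is
    -- orthogonal to `d k ^ p ^ (j + 1)`; so is `b`. These `n` independent equations in `n + 1`
    -- unknowns have a one-dimensional solution space, so the two vectors are proportional. The
    -- factor `t` is read off at coordinate `0`.
    let w : Fin (n + 1) → F := fun k => x k ^ p - x k -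
      (x 0 ^ p - x 0) / b (i₀.succAbove 0) * b (i₀.succAbove k)
    have hw0 : w 0 = 0 := by
      simp only [w]
      rw [div_mul_cancel₀ _ (hbi _), sub_self]
    have hsum : ∀ j < n, ∑ k, d k ^ p ^ (j + 1) * w k = 0 := by
      intro j hj
      have h1 : ∑ k, d k ^ p ^ (j + 1) * x k ^ p = z ^ p ^ (j + 1) := by
        rw [pow_succ p, pow_mul z, ← hx j (by omega), sum_pow_char]
        simp only [mul_pow, ← pow_mul, ← pow_succ]
      have h2 : ∑ k, d k ^ p ^ (j + 1) * b (i₀.succAbove k) = 0 := by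
        simp only [hdpow, sub_mul, Finset.sum_sub_distrib]
        rw [hb' (j + 1) (by omega), hb' j (by omega), sub_self]
      simp only [w, mul_sub, Finset.sum_sub_distrib, mul_left_comm _ (_ / _), ← Finset.mul_sum]
      rw [h1, h2, hx (j + 1) (by omega), sub_self, mul_zero, sub_zero]
    have hw := moore_eq_zero (hd.pow_char.comp _ (Fin.succ_injective n))
      (x := fun k => w k.succ) fun j hj => by
        have := hsum j hj
        rw [Fin.sum_univ_succ, hw0, mul_zero, zero_add] at this
        rw [← this]
        simp only [Function.comp_apply, ← pow_mul, pow_succ']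
    refine ⟨(x 0 ^ p - x 0) / b (i₀.succAbove 0), fun k => ?_⟩
    rw [← sub_eq_iff_eq_add', ← sub_eq_zero]
    refine k.cases hw0 (fun k => congrFun hw k)
  obtain ⟨x₀, hx₀⟩ := H t fun i hi => by
    obtain ⟨k, rfl⟩ := Fin.exists_succAbove_eq hi
    exact ⟨x k, ht k⟩
  -- Its image under ℘ is `∑ d k * x k = z` plus `t` times `∑ e i ^ p * b i = 0`.
  refine ⟨x₀ + ∑ k, e (i₀.succAbove k) * x k, ?_⟩
  have h0 := hx 0 (by omega)
  have h1 := hb' 0 (by omega)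
  simp only [pow_zero, pow_one, zero_add] at h0 h1
  rw [add_pow_char, sum_pow_char, hx₀, ← h0]
  simp only [mul_pow, ht, mul_add, d, sub_mul, Finset.sum_add_distrib, Finset.sum_sub_distrib,
    mul_left_comm _ t, ← Finset.mul_sum]
  rw [h1]
  ring

end ArtinSchreier

/-! ### Definability of ring operations and of arithmetic in finite extensions. -/

section DefinableField

open FirstOrder Set

/-- The image of the embedding `e` of the ring `k` into the structure `M` is definable with
parameters, and so are the graphs of the ring operations on it. -/
structure IsDefinableRing (L : FirstOrder.Language) {M : Type*} [L.Structure M] {k : Type*} [CommRing k]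
    (e : k → M) : Prop where
  injective : Function.Injective e
  range : (univ : Set M).Definable L {w : Fin 1 → M | ∃ x, w = ![e x]}
  add : (univ : Set M).Definable L {w : Fin 3 → M | ∃ x y, w = ![e x, e y, e (x + y)]}
  mul : (univ : Set M).Definable L {w : Fin 3 → M | ∃ x y, w = ![e x, e y, e (x * y)]}

/-- A function on tuples of a ring that is embedded into the structure `M` is definable if it
becomes definable (with parameters) when tuples of elements of `M` are decoded by a left inverse
of the embedding. -/
def DefinableVia (L : FirstOrder.Language) {M : Type*} [L.Structure M] {k : Type*} [Nonempty k] (e : k → M)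
    {α : Type*} (f : (α → k) → k) : Prop :=
  (univ : Set M).DefinableFun L fun w => e (f (Function.invFun e ∘ w))

namespace IsDefinableRing

variable {L : FirstOrder.Language} {M : Type*} [L.Structure M] {k : Type*} [CommRing k] {e : k → M}
  (he : IsDefinableRing L e) {α : Type*}

include he in
theorem invFun_apply (x : k) : Function.invFun e (e x) = x :=
  Function.leftInverse_invFun he.injective x

include he in
theorem definableVia_apply (i : α) : DefinableVia L e fun u : α → k => u i := by
  classical
  -- Off the range of `e` the decoding takes one default value, which is a parameter.
  have h : (fun w : α → M => e ((Function.invFun e ∘ w) i)) = fun w : α → M =>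
      if ∃ x, e x = w i then w i else e (Classical.arbitrary k) := by
    funext w
    by_cases hw : ∃ x, e x = w i
    · rw [if_pos hw, Function.comp_apply, Function.invFun_eq hw]
    · rw [if_neg hw, Function.comp_apply, Function.invFun_neg hw]
  rw [DefinableVia, h]
  refine DefinableFun.ite ?_ (DefinableFun.proj L) (L.definableFun_const _ (mem_univ _))
  convert! he.range.preimage_comp (fun _ => i) using 1
  ext w
  simp only [mem_ofPred_eq, mem_preimage]
  refine exists_congr fun x => ⟨fun h => funext fun j => ?_, fun h => (congrFun h 0).symm⟩
  rw [Subsingleton.elim j 0]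
  exact h.symm

theorem definableVia_const (c : k) : DefinableVia L e fun _ : α → k => c :=
  L.definableFun_const _ (mem_univ _)

theorem definableVia_of_graph {g : k → k → k}
    (hg : (univ : Set M).Definable L {w : Fin 3 → M | ∃ x y, w = ![e x, e y, e (g x y)]})
    (hinj : Function.Injective e) {f₁ f₂ : (α → k) → k} (h₁ : DefinableVia L e f₁)
    (h₂ : DefinableVia L e f₂) : DefinableVia L e fun u => g (f₁ u) (f₂ u) := by
  let F : (Option α → M) → Fin 3 → M := fun w =>
    ![e (f₁ (Function.invFun e ∘ w ∘ some)), e (f₂ (Function.invFun e ∘ w ∘ some)), w none]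
  have hF : (univ : Set M).DefinableMap L F := by
    have hsome : ∀ f : (α → k) → k, DefinableVia L e f →
        (univ : Set M).DefinableFun L fun w : Option α → M =>
          e (f (Function.invFun e ∘ w ∘ some)) := by
      intro f hf
      simpa [DefinableFun, Function.tupleGraph] using!
        hf.preimage_comp (fun | none => none | some i => some (some i))
    intro i
    fin_cases i
    · exact hsome f₁ h₁
    · exact hsome f₂ h₂
    · exact DefinableFun.proj L
  have := hg.preimage_map hF
  rw [DefinableVia, DefinableFun]
  convert! this using 1
  ext w
  simp only [Function.tupleGraph, mem_ofPred_eq, mem_preimage, F]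
  constructor
  · intro h
    exact ⟨_, _, by rw [← h]⟩
  · rintro ⟨x, y, h⟩
    have hx := hinj (congrFun h 0)
    have hy := hinj (congrFun h 1)
    have hz : w none = e (g x y) := congrFun h 2
    rw [hz, ← hx, ← hy]

variable {f₁ f₂ : (α → k) → k}

include he

theorem definableVia_add (h₁ : DefinableVia L e f₁) (h₂ : DefinableVia L e f₂) :
    DefinableVia L e fun u => f₁ u + f₂ u :=
  definableVia_of_graph he.add he.injective h₁ h₂

theorem definableVia_mul (h₁ : DefinableVia L e f₁) (h₂ : DefinableVia L e f₂) :
    DefinableVia L e fun u => f₁ u * f₂ u :=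
  definableVia_of_graph he.mul he.injective h₁ h₂

theorem definableVia_sum {ι : Type*} (s : Finset ι) {f : ι → (α → k) → k}
    (h : ∀ i, DefinableVia L e (f i)) : DefinableVia L e fun u => ∑ i ∈ s, f i u := by
  classical
  induction s using Finset.induction with
  | empty => simpa using definableVia_const 0
  | insert i s hi ih =>
    simp only [Finset.sum_insert hi]
    exact he.definableVia_add (h i) ih

end IsDefinableRing

namespace IsDefinableRing

variable {L : FirstOrder.Language} {M : Type*} [L.Structure M] {k : Type*} [CommRing k] {e : k → M}
  (he : IsDefinableRing L e) {α ι : Type*} {l : Type*} [CommRing l] [Algebra k l]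
  (B : Module.Basis ι k l) {f₁ f₂ : (α → k) → l}
include he

theorem definableVia_repr_add (h₁ : ∀ s, DefinableVia L e fun u => B.repr (f₁ u) s)
    (h₂ : ∀ s, DefinableVia L e fun u => B.repr (f₂ u) s) (s : ι) :
    DefinableVia L e fun u => B.repr (f₁ u + f₂ u) s := by
  simpa using he.definableVia_add (h₁ s) (h₂ s)

/-- Coordinates of a product are bilinear in those of the factors; the structure constants of the
basis serve as parameters. -/
theorem definableVia_repr_mul [Finite ι] (h₁ : ∀ s, DefinableVia L e fun u => B.repr (f₁ u) s)
    (h₂ : ∀ s, DefinableVia L e fun u => B.repr (f₂ u) s) (s : ι) :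
    DefinableVia L e fun u => B.repr (f₁ u * f₂ u) s := by
  have := Fintype.ofFinite ι
  have h : ∀ u, B.repr (f₁ u * f₂ u) s =
      ∑ i, ∑ j, B.repr (f₁ u) i * B.repr (f₂ u) j * B.repr (B i * B j) s := by
    intro u
    conv_lhs => rw [← B.sum_repr (f₁ u), ← B.sum_repr (f₂ u)]
    simp only [Finset.sum_mul_sum, smul_mul_smul_comm, map_sum, Finsupp.finsetSum_apply,
      map_smul, Finsupp.smul_apply, smul_eq_mul]
  simp only [h]
  exact he.definableVia_sum _ fun i => he.definableVia_sum _ fun j =>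
    he.definableVia_mul (he.definableVia_mul (h₁ i) (h₂ j)) (definableVia_const _)

theorem definableVia_repr_pow [Finite ι] (h₁ : ∀ s, DefinableVia L e fun u => B.repr (f₁ u) s) (n : ℕ)
    (s : ι) : DefinableVia L e fun u => B.repr (f₁ u ^ n) s := by
  induction n generalizing s with
  | zero => simpa using definableVia_const _
  | succ n ih =>
    simp only [pow_succ]
    exact he.definableVia_repr_mul B ih h₁ s

end IsDefinableRing

end DefinableField

/-! ### The Kaplan–Scanlon–Wagner theorem. -/

section NIP

open FirstOrder Set

variable {L : FirstOrder.Language.{0, 0}} {M : Type*} [L.Structure M] [Nonempty M] {k : Type*} [Field k]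
  {e : k → M} {l : Type*} [Field l] [Algebra k l] [FiniteDimensional k l]

/-- An infinite finite extension of a field that is definable in a structure with NIP theory is
Artin-Schreier closed (Kaplan-Scanlon-Wagner). -/
theorem IsDefinableRing.isArtinSchreierClosed (he : IsDefinableRing L e)
    (hnip : (L.completeTheory M).IsNIP) (p : ℕ) [Fact p.Prime] [CharP l p] [Infinite l] :
    IsArtinSchreierClosed p l := by
  classical
  let B := Module.finBasis k l
  let ι := Fin (Module.finrank k l)
  let dec : (ι → M) → l := fun w => B.equivFun.symm (Function.invFun e ∘ w)
  let enc : l → ι → M := fun x => e ∘ B.equivFun x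
  have hdec : ∀ x, dec (enc x) = x := fun x => by
    have : Function.invFun e ∘ enc x = B.equivFun x := funext fun s => he.invFun_apply _
    simp only [dec, this, LinearEquiv.symm_apply_apply]
  let S : Set (ι ⊕ ι → M) := {w | ∃ x : ι → M,
    dec x ^ p = dec x + dec (w ∘ Sum.inr) * dec (w ∘ Sum.inl)}
  have hS : (univ : Set M).Definable L S := by
    let c : (ι → (ι ⊕ ι) ⊕ ι) → ((ι ⊕ ι) ⊕ ι → k) → l := fun j u => B.equivFun.symm (u ∘ j)
    have hc : ∀ j s, DefinableVia L e fun u => B.repr (c j u) s := fun j s => by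
      have : ∀ u, B.repr (c j u) s = u (j s) := fun u => by
        rw [← B.equivFun_apply, LinearEquiv.apply_symm_apply, Function.comp_apply]
      simp only [this]
      exact he.definableVia_apply _
    let X := c Sum.inr
    let T := c (Sum.inl ∘ Sum.inr)
    let A := c (Sum.inl ∘ Sum.inl)
    have hdef : (univ : Set M).Definable L (⋂ s, {w : (ι ⊕ ι) ⊕ ι → M |
        e (B.repr (X (Function.invFun e ∘ w) ^ p) s) =
          e (B.repr (X (Function.invFun e ∘ w) +
            T (Function.invFun e ∘ w) * A (Function.invFun e ∘ w)) s)}) :=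
      definable_iInter_of_finite fun s => DefinableFun.ofPred_eq
        (he.definableVia_repr_pow B (hc _) p s)
        (he.definableVia_repr_add B (hc _) (he.definableVia_repr_mul B (hc _) (hc _)) s)
    convert! hdef.exists_of_finite using 1
    ext w
    simp only [S, mem_ofPred_eq, mem_iInter, he.injective.eq_iff]
    refine exists_congr fun x => ?_
    rw [← Finsupp.ext_iff, B.repr.injective.eq_iff]
    rfl
  -- The complement is used because a sum of the witnesses `g k` over `I` fails to lie in the `i`-th
  -- subgroup exactly when `i ∈ I`: each `g k` lies in every subgroup but the `k`-th.
  obtain ⟨N, hN⟩ := hnip.exists_forall_not_shatters hS.compl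
  obtain ⟨b, hb⟩ := exists_forall_isArtinSchreierClosed (p := p) (F := l) N
  by_contra hcon
  have hg : ∀ i₀, ∃ t, (∀ i, i ≠ i₀ → ∃ x, x ^ p = x + t * b i) ∧
      ¬ ∃ x, x ^ p = x + t * b i₀ := fun i₀ => by
    by_contra! h
    exact hcon (hb i₀ fun t ht => h t ht)
  choose g hg hg' using hg
  refine hN (fun i => enc (b i.castSucc))
    (fun I => enc (∑ k with k ∈ I, g k.castSucc)) fun i I => ?_
  have hmem : Sum.elim (enc (b i.castSucc)) (enc (∑ k with k ∈ I, g k.castSucc)) ∈ S ↔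
      ∃ x, x ^ p = x + (∑ k with k ∈ I, g k.castSucc) * b i.castSucc := by
    simp only [S, mem_ofPred_eq, Sum.elim_comp_inl, Sum.elim_comp_inr, hdec]
    exact ⟨fun ⟨x, hx⟩ => ⟨_, hx⟩, fun ⟨x, hx⟩ => ⟨enc x, by rw [hdec, hx]⟩⟩
  -- the elements `t` for which `x ^ p = x + t * b i` is solvable form a subgroup
  let H : AddSubgroup l :=
    { carrier := {t | ∃ x, x ^ p = x + t * b i.castSucc}
      zero_mem' := ⟨0, by simp [(Fact.out : p.Prime).ne_zero]⟩
      add_mem' := by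
        rintro s t ⟨x, hx⟩ ⟨y, hy⟩
        exact ⟨x + y, by rw [add_pow_char, hx, hy]; ring⟩
      neg_mem' := by
        rintro s ⟨x, hx⟩
        exact ⟨-x, by rw [← zero_sub, sub_pow_char, hx, zero_pow (Fact.out : p.Prime).ne_zero]; ring⟩ }
  have hH : ∀ k, k ≠ i → g k.castSucc ∈ H := fun k hk => hg _ _ (by simpa using hk.symm)
  rw [mem_compl_iff, hmem]
  change (∑ k with k ∈ I, g k.castSucc) ∉ H ↔ i ∈ I
  constructor
  · intro h
    by_contra hi
    exact h (sum_mem fun k hk => hH k (by rintro rfl; exact hi (by simpa using hk)))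
  · intro hi h
    rw [← Finset.add_sum_erase _ _ (a := i) (by simpa using hi),
      H.add_mem_cancel_right (sum_mem fun k hk => hH k (Finset.ne_of_mem_erase hk))] at h
    exact hg' _ h

end NIP

/-! ### Separable extensions of degree divisible by `p`. -/

section Cyclic

variable {p : ℕ} [hp : Fact p.Prime] {k l : Type*} [Field k] [Field l] [Algebra k l]

/-- An automorphism `σ ≠ 1` with `σ ^ p = 1` of a field of characteristic `p` moves some element
by `1`. -/
theorem AlgEquiv.exists_apply_eq_add_one [CharP l p] (σ : l ≃ₐ[k] l) (h1 : σ ≠ 1)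
    (hσ : σ ^ p = 1) : ∃ y, σ y = y + 1 := by
  classical
  have : CharP k p := (algebraMap k l).charP (algebraMap k l).injective p
  have : CharP (Module.End k l) p :=
    charP_of_injective_algebraMap (algebraMap k (Module.End k l)).injective p
  -- `D = σ - 1` is nilpotent because `D ^ p = σ ^ p - 1 = 0`. Its last nonzero power takes values
  -- fixed by `σ`, so one may divide by them.
  let D : Module.End k l := σ.toLinearMap - 1
  have hDy : ∀ y, D y = σ y - y := fun y => rfl
  have hD : D ^ p = 0 := by
    rw [sub_pow_char_of_commute _ (Commute.one_right _), one_pow, sub_eq_zero]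
    ext y
    rw [Module.End.pow_apply]
    exact congrFun ((AlgEquiv.coe_pow σ p).symm.trans (congrArg _ hσ)) y
  have hex : ∃ n, D ^ n = 0 := ⟨p, hD⟩
  have hn := Nat.find_spec hex
  obtain ⟨n, hn'⟩ : ∃ n, Nat.find hex = n + 2 := by
    rcases h : Nat.find hex with _ | _ | n
    · rw [h, pow_zero] at hn
      exact absurd (LinearMap.congr_fun hn 1) one_ne_zero
    · rw [h, zero_add, pow_one] at hn
      refine absurd (AlgEquiv.ext fun y => ?_) h1
      exact sub_eq_zero.1 (LinearMap.congr_fun hn y)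
    · exact ⟨n, rfl⟩
  have hmin : D ^ (n + 1) ≠ 0 := Nat.find_min hex (by omega)
  rw [hn'] at hn
  obtain ⟨w, hw⟩ : ∃ w, (D ^ (n + 1)) w ≠ 0 := by
    by_contra! h
    exact hmin (LinearMap.ext h)
  have hfix : σ ((D ^ (n + 1)) w) = (D ^ (n + 1)) w := by
    rw [← sub_eq_zero, ← hDy, ← Module.End.mul_apply, ← pow_succ', hn, LinearMap.zero_apply]
  refine ⟨(D ^ n) w / (D ^ (n + 1)) w, ?_⟩
  have hstep : σ ((D ^ n) w) = (D ^ n) w + (D ^ (n + 1)) w := by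
    rw [pow_succ' D n, Module.End.mul_apply, hDy]
    ring
  rw [map_div₀, hfix, hstep, add_div, div_self hw]

/-- If all finite extensions of a field of characteristic `p` are Artin-Schreier closed, then it has
no finite separable extension of degree divisible by `p`. -/
theorem not_dvd_finrank_of_isArtinSchreierClosed {k : Type u} [Field k] [CharP k p]
    (h : ∀ (E : Type u) [Field E] [Algebra k E] [FiniteDimensional k E],
      IsArtinSchreierClosed p E)
    (l : Type u) [Field l] [Algebra k l] [FiniteDimensional k l] [Algebra.IsSeparable k l] :
    ¬ p ∣ Module.finrank k l := by
  intro hdvd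
  let N := IntermediateField.normalClosure k l (SeparableClosure l)
  have : Algebra.IsSeparable k (SeparableClosure l) := Algebra.IsSeparable.trans k l _
  have : IsGalois k (SeparableClosure l) := { to_normal := normal_iff.2 fun x =>
    ⟨Algebra.IsIntegral.isIntegral x, IsSepClosed.splits_of_separable _
      (Polynomial.Separable.map (Algebra.IsSeparable.isSeparable k x))⟩ }
  have : IsGalois k N := IsGalois.normalClosure k l (SeparableClosure l)
  have : FiniteDimensional k N := inferInstance
  have hdvd' : p ∣ Nat.card (N ≃ₐ[k] N) := by
    rw [IsGalois.card_aut_eq_finrank, ← Module.finrank_mul_finrank k l N]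
    exact hdvd.mul_right _
  obtain ⟨σ, hσ⟩ := exists_prime_orderOf_dvd_card' p hdvd'
  have : CharP N p := charP_of_injective_algebraMap (algebraMap k N).injective p
  obtain ⟨y, hy⟩ := AlgEquiv.exists_apply_eq_add_one (p := p) σ
    (by rintro rfl; exact hp.out.one_lt.ne (by simpa using hσ)) (hσ ▸ pow_orderOf_eq_one σ)
  let E := IntermediateField.fixedField (Subgroup.zpowers σ)
  have hE : ∀ z, σ z = z → z ∈ E := fun z hz => by
    rw [IntermediateField.mem_fixedField_iff]
    intro τ hτ
    obtain ⟨n, rfl⟩ := Subgroup.mem_zpowers_iff.1 hτ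
    exact (Subgroup.zpowers_le (H := MulAction.stabilizer (N ≃ₐ[k] N) z)).2 hz hτ
  have hEσ : ∀ z : E, σ z = z := fun z =>
    (IntermediateField.mem_fixedField_iff _ _).1 z.2 σ (Subgroup.mem_zpowers σ)
  -- `y ^ p - y` is fixed by `σ`. A preimage `x` in `E` differs from `y` by an element of the prime
  -- field, so `σ` would fix `y`.
  obtain ⟨x, hx⟩ := h E ⟨y ^ p - y, hE _ (by
    rw [map_sub, map_pow, hy, add_pow_char, one_pow, add_sub_add_right_eq_sub])⟩
  have hx : (x : N) ^ p - x = y ^ p - y := congrArg Subtype.val hx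
  have hyx : (y - x : N) ^ p = y - x := by
    rw [sub_pow_char, sub_eq_sub_iff_add_eq_add]
    linear_combination -hx
  obtain ⟨r, hr⟩ : ∃ r : ZMod p, ZMod.castHom dvd_rfl N r = y - x := by
    rw [← Subfield.mem_bot_iff_pow_eq_self N p, ← ZMod.fieldRange_castHom_eq_bot p] at hyx
    exact hyx
  have hσr : σ (y - x) = y - x := by
    rw [← hr]
    exact DFunLike.congr_fun (Subsingleton.elim
      ((σ : N →+* N).comp (ZMod.castHom dvd_rfl N)) (ZMod.castHom dvd_rfl N)) r
  rw [map_sub, hEσ, hy] at hσr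
  exact one_ne_zero (by linear_combination hσr : (1 : N) = 0)

end Cyclic

/-! ### Consequences for the value group and the residue field; the equivalence. -/

namespace ValuedField

open FirstOrder Set

variable {K : Type u} [Field K] {Γ₀ : Type v} [LinearOrderedCommGroupWithZero Γ₀]
  (v : Valuation K Γ₀)

theorem definable_holds {n : ℕ} (r : Rel n) :
    (univ : Set (Sorts v)).Definable language {w : Fin n → Sorts v | Rel.Holds v r w} := by
  refine (show (∅ : Set (Sorts v)).Definable language _ from ?_).mono (empty_subset _)
  refine empty_definable_iff.2 ⟨Language.Relations.formula (L := language) r fun i => .var i, ?_⟩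
  ext w
  rfl

theorem isDefinableRing_field : IsDefinableRing language (Sorts.field (v := v)) where
  injective _ _ := Sorts.field.inj
  range := definable_holds v .fieldSort
  add := definable_holds v .fieldAdd
  mul := definable_holds v .fieldMul

theorem isDefinableRing_residue : IsDefinableRing language (Sorts.residue (v := v)) where
  injective _ _ := Sorts.residue.inj
  range := definable_holds v .residueSort
  add := definable_holds v .residueAdd
  mul := definable_holds v .residueMul

instance : Nonempty (Sorts v) := ⟨.field 0⟩

variable {v} {p : ℕ} [hp : Fact p.Prime]

/-- If `v a > 1` and `x ^ p - x = a`, then `x` is not integral, so `x ^ p` dominates and `v x ^ p =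
v a`. Inverses handle the values below `1`. -/
theorem isGroupDivisible_of_isArtinSchreierClosed (hv : Function.Surjective v)
    (h : IsArtinSchreierClosed p K) : IsGroupDivisible p Γ₀ := by
  have key : ∀ g : Γ₀ˣ, 1 < g → ∃ h : Γ₀ˣ, h ^ p = g := by
    intro g hg
    have hg' : (1 : Γ₀) < g := by exact_mod_cast hg
    obtain ⟨a, ha⟩ := hv g
    obtain ⟨x, hx⟩ := h a
    have hx1 : 1 < v x := by
      by_contra! hle
      have : v a ≤ 1 := by
        rw [← hx]
        exact v.map_sub_le (by rw [map_pow]; exact pow_le_one₀ zero_le hle) hle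
      exact absurd (ha ▸ this) (not_le.2 hg')
    have hlt : v x < v (x ^ p) := by
      rw [map_pow]
      exact lt_self_pow₀ hx1 hp.out.one_lt
    have hxa : v x ^ p = g := by
      rw [← ha, ← hx, Valuation.map_sub_eq_of_lt_left _ hlt, map_pow]
    refine ⟨Units.mk0 (v x) (zero_lt_one.trans hx1).ne', ?_⟩
    ext
    simpa using hxa
  intro g
  rcases lt_trichotomy g 1 with hg | rfl | hg
  · obtain ⟨h, hh⟩ := key g⁻¹ (by simpa using hg)
    exact ⟨h⁻¹, by rw [inv_pow, hh, inv_inv]⟩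
  · exact ⟨1, one_pow p⟩
  · exact key g hg

theorem charP_residue [CharP K p] : CharP (Residue v) p := by
  rw [CharP.charP_iff_prime_eq_zero hp.out, ← map_natCast (IsLocalRing.residue v.valuationSubring)]
  have : (p : v.valuationSubring) = 0 := Subtype.ext (by simp)
  rw [this, map_zero]

/-- A preimage of an integral element is integral, for otherwise `x ^ p` would dominate; so it can
be reduced. -/
theorem isArtinSchreierClosed_residue (h : IsArtinSchreierClosed p K) :
    IsArtinSchreierClosed p (Residue v) := by
  intro a
  obtain ⟨a, rfl⟩ := IsLocalRing.residue_surjective a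
  obtain ⟨x, hx⟩ := h a
  have hx1 : v x ≤ 1 := by
    by_contra! hlt
    have hlt' : v x < v (x ^ p) := by
      rw [map_pow]
      exact lt_self_pow₀ hlt hp.out.one_lt
    have : v (a : K) = v (x ^ p) := by
      rw [← hx, Valuation.map_sub_eq_of_lt_left _ hlt']
    exact absurd a.2 (not_le.2 (this ▸ hlt.trans hlt'))
  refine ⟨IsLocalRing.residue _ ⟨x, hx1⟩, ?_⟩
  rw [← map_pow, ← map_sub]
  exact congrArg _ (Subtype.ext hx)

end ValuedField

/-- The map ℘ sends both `0` and `1` to `0`, so on a finite field it cannot be onto. -/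
theorem IsArtinSchreierClosed.infinite {p : ℕ} [hp : Fact p.Prime] {F : Type*} [Field F]
    (h : IsArtinSchreierClosed p F) : Infinite F := by
  by_contra hF
  have : Finite F := not_infinite_iff_finite.1 hF
  have hinj := Finite.injective_iff_surjective.2 h
  exact zero_ne_one (hinj (a₁ := 0) (a₂ := 1) (by simp [hp.out.ne_zero]))

theorem corollary5p10 {K : Type u} [Field K] [Infinite K] (p : ℕ) [Fact p.Prime] [CharP K p]
    {Γ₀ : Type v} [LinearOrderedCommGroupWithZero Γ₀]
    (v : Valuation K Γ₀) (hv : Function.Surjective v)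
    (hmax : ValuedField.IsAlgebraicallyMaximal v) (hnip : ValuedField.IsNIP v) :
    [ValuedField.IsTame p v, ValuedField.IsKaplansky p v,
      PerfectField (ValuedField.Residue v)].TFAE := by
  have hK : IsArtinSchreierClosed p K :=
    (ValuedField.isDefinableRing_field v).isArtinSchreierClosed (l := K) hnip p
  have hdiv := ValuedField.isGroupDivisible_of_isArtinSchreierClosed hv hK
  have hk := ValuedField.isArtinSchreierClosed_residue (v := v) hK
  have := hk.infinite
  have := ValuedField.charP_residue (v := v) (p := p)
  have hfin := not_dvd_finrank_of_isArtinSchreierClosed (p := p) (k := ValuedField.Residue v)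
    fun E _ _ _ => by
      have : CharP E p :=
        charP_of_injective_algebraMap (algebraMap (ValuedField.Residue v) E).injective p
      have : Infinite E :=
        Infinite.of_injective _ (algebraMap (ValuedField.Residue v) E).injective
      exact (ValuedField.isDefinableRing_residue v).isArtinSchreierClosed hnip p
  tfae_have 1 → 3 := fun h => h.perfect
  tfae_have 2 → 3 := fun h => h.perfect
  tfae_have 3 → 1 := fun h => ⟨hmax, hdiv, h⟩
  tfae_have 3 → 2 := fun h => ⟨hdiv, h, fun l _ _ _ _ => hfin l⟩
  tfae_finish
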